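/- Order $[0,\infty]$ by the reverse of the usual order and use $+$ as tensor product with unit $0$; call this quantale $\mathsf P_+$. Let $\mathbb U=(U,e,m)$ be the ultrafilter monad on sets: $UX$ is the set of ultrafilters on $X$, $e_X(x)$ is the principal ultrafilter at $x$, $Uf(\mathfrak x)$ is the image ultrafilter of $\mathfrak x$ under a map $f$, and $A\in m_X(\mathfrak X)\iff\{\mathfrak x\in UX\mid A\in\mathfrak x\}\in\mathfrak X$. For $r:X\times Y\to[0,\infty]$ put, for $\mathfrak x\in UX$ and $\mathfrak y\in UY$, $$Ur(\mathfrak x,\mathfrak y)=\sup_{A\in\mathfrak x,\,B\in\mathfrak y}\ \inf_{x\in A,\,y\in B} r(x,y).$$ (Here and below $\inf$, $\sup$, $\le$, $\ge$ refer to the usual order of $[0,\infty]$.) An approach space $X=(X,a)$ is given as a $(\mathbb U,\mathsf P_+)$-category: a set $X$ with a map $a:UX\times X\to[0,\infty]$ such that $a(e_X(x),x)=0$ and $a(m_X(\mathfrak X),x)\le Ua(\mathfrak X,\mathfrak x)+a(\mathfrak x,x)$ for all $x\in X$, $\mathfrak x\in UX$, $\mathfrak X\in UUX$. A functor (non-expansive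 map) $f:(Y,b)\to(X,a)$ is a map $f:Y\to X$ with $a(Uf(\mathfrak y),f(y))\le b(\mathfrak y,y)$ for all $\mathfrak y\in UY$, $y\in Y$. For $\alpha:UX\times Y\to[0,\infty]$ and $\beta:UY\times Z\to[0,\infty]$, the Kleisli composite is $$(\beta*\alpha)(\mathfrak x,z)=\inf\{U\alpha(\mathfrak X,\mathfrak y)+\beta(\mathfrak y,z)\mid \mathfrak y\in UY,\ \mathfrak X\in UUX,\ m_X(\mathfrak X)=\mathfrak x\}.$$ A bimodule from $(X,a)$ to $(Y,b)$ is a map $\psi:UX\times Y\to[0,\infty]$ with $\psi*a\ge\psi$ and $b*\psi\ge\psi$ pointwise. Bimodules $\varphi$ from $(Y,b)$ to $(X,a)$ and $\psi$ from $(X,a)$ to $(Y,b)$ are adjoint, $\varphi\dashv\psi$, if $\psi*\varphi\le b$ and $\varphi*\psi\ge a$ pointwise. The space $(X,a)$ is Lawvere-complete if for every approach space $(Y,b)$ and all adjoint bimodules $\varphi\dashv\psi$ as above there is a functor $f:(Y,b)\to(X,a)$ with $\varphi(\mathfrak y,x)=a(Uf(\mathfrak y),x)$ and $\psi(\mathfrak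 x,y)=a(\mathfrak x,f(y))$ for all $\mathfrak x\in UX$, $x\in X$, $\mathfrak y\in UY$, $y\in Y$. For $A\subseteq X$ and $x\in X$ let $d(A,x)=\inf\{a(\mathfrak x,x)\mid \mathfrak x\in UX,\ A\in\mathfrak x\}$. A variable set in $X$ is a family $A=(A_v)_{v\in[0,\infty]}$ of subsets of $X$ with $A_v=\bigcap_{u>v}A_u$ for all $v$ (so that $A_\infty=X$). It is closed if $d(A_u,x)\le v$ implies $x\in A_{u+v}$ for all $u,v\in[0,\infty]$ and $x\in X$. It is irreducible if for every $u\in(0,\infty]$ there is an ultrafilter $\mathfrak x$ on $X$ with $A_u\in\mathfrak x$ such that $a(\mathfrak x,x)\le w+u$ for all $w\in[0,\infty]$ and all $x\in A_w$. It is representable if there is a point $x\in X$ with $A_v=\{y\in X\mid d(\{x\},y)\le v\}$ for all $v\in[0,\infty]$. **Theorem.** The following assertions are equivalent for an approach space $X$. (i) $X$ is Lawvere-complete. (ii) Each irreducible closed variable set in $X$ is representable. -/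

import Mathlib

open scoped ENNReal

universe u v w

namespace UApp

/-- `[0,∞]`-valued matrices from `X` to `Y`.  The quantale in use is `[0,∞]` with tensor product `+`
and unit `0`, ordered by the *reverse* of the numerical order; so joins in the quantale are
numerical infima, meets are numerical suprema, and its bottom element is `∞`. -/
abbrev PMat (X : Type u) (Y : Type v) : Type (max u v) := X → Y → ℝ≥0∞

namespace PMat

variable {X : Type u} {Y : Type v} {Z : Type w}

/-- The pointwise order of matrices taken in the quantale, i.e. the reverse of the numerical one. -/
def QLE (r r' : PMat X Y) : Prop := ∀ x y, r' x y ≤ r x y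

/-- Matrix composition `s · r`, with `(s · r)(x,z) = ⋁_y r(x,y) ⊗ s(y,z)`. -/
noncomputable def comp (s : PMat Y Z) (r : PMat X Y) : PMat X Z :=
  fun x z => ⨅ y, r x y + s y z

/-- The transpose `r°`. -/
def transpose (r : PMat X Y) : PMat Y X := fun y x => r x y

/-- A map as a matrix: the unit `0` on the graph, the bottom element `∞` elsewhere. -/
noncomputable def ofMap (f : X → Y) : PMat X Y :=
  fun x y => ⨅ _ : f x = y, 0

/-- The extension of the ultrafilter functor to matrices,
`Ur(𝔵,𝔶) = ⋀_{A ∈ 𝔵, B ∈ 𝔶} ⋁_{x ∈ A, y ∈ B} r(x,y)` in the quantale. -/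
noncomputable def ext (r : PMat X Y) : PMat (Ultrafilter X) (Ultrafilter Y) :=
  fun 𝔵 𝔶 => ⨆ A ∈ 𝔵, ⨆ B ∈ 𝔶, ⨅ x ∈ A, ⨅ y ∈ B, r x y

end PMat

/-- The multiplication of the ultrafilter monad. -/
noncomputable def mult {X : Type u} (𝔛 : Ultrafilter (Ultrafilter X)) : Ultrafilter X :=
  Ultrafilter.bind 𝔛 id

theorem mem_mult {X : Type u} (𝔛 : Ultrafilter (Ultrafilter X)) (A : Set X) :
    A ∈ mult 𝔛 ↔ {𝔵 : Ultrafilter X | A ∈ 𝔵} ∈ 𝔛 := Iff.rfl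

/-- Kleisli composition `b ∗ a = b · Ua · m°`. -/
noncomputable def kleisli {X : Type u} {Y : Type v} {Z : Type w}
    (b : PMat (Ultrafilter Y) Z) (a : PMat (Ultrafilter X) Y) : PMat (Ultrafilter X) Z :=
  b.comp (a.ext.comp (PMat.ofMap mult).transpose)

/-- An approach space, presented by its ultrafilter convergence: a category enriched in
the ultrafilter monad and `[0,∞]` with `+`.  The unit of the monad is `pure`. -/
structure ApproachSpace (X : Type u) where
  /-- the structure matrix -/
  conv : PMat (Ultrafilter X) X
  refl : ∀ x, conv (pure x) x ≤ 0
  trans : ∀ (𝔛 : Ultrafilter (Ultrafilter X)) (𝔵 : Ultrafilter X) (x : X),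
    conv (mult 𝔛) x ≤ conv.ext 𝔛 𝔵 + conv 𝔵 x

/-- Functors of such categories, i.e. non-expansive maps. -/
def IsFunctor {X : Type u} {Y : Type v} (a : ApproachSpace X) (b : ApproachSpace Y)
    (f : X → Y) : Prop :=
  ∀ (𝔵 : Ultrafilter X) (x : X), b.conv (𝔵.map f) (f x) ≤ a.conv 𝔵 x

/-- Bimodules `ψ : (X,a) ⇸ (Y,b)`. -/
structure IsBimodule {X : Type u} {Y : Type v} (a : ApproachSpace X) (b : ApproachSpace Y)
    (ψ : PMat (Ultrafilter X) Y) : Prop where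
  right : (kleisli ψ a.conv).QLE ψ
  left : (kleisli b.conv ψ).QLE ψ

/-- Adjoint bimodules `φ ⊣ ψ`, where `φ : (Y,b) ⇸ (X,a)` and `ψ : (X,a) ⇸ (Y,b)`; the identity
bimodules are the structure matrices. -/
structure IsAdjoint {Y : Type u} {X : Type v} (b : ApproachSpace Y) (a : ApproachSpace X)
    (φ : PMat (Ultrafilter Y) X) (ψ : PMat (Ultrafilter X) Y) : Prop where
  bimodule_left : IsBimodule b a φ
  bimodule_right : IsBimodule a b ψ
  unit : b.conv.QLE (kleisli ψ φ)
  counit : (kleisli φ ψ).QLE a.conv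

/-- The matrix `f_* = b · Uf` of a map `f` into `(Y,b)`. -/
def lowerStar {X : Type u} {Y : Type v} (b : ApproachSpace Y) (f : X → Y) :
    PMat (Ultrafilter X) Y := fun 𝔵 y => b.conv (𝔵.map f) y

/-- The matrix `f^* = f° · b` of a map `f` into `(Y,b)`. -/
def upperStar {X : Type u} {Y : Type v} (b : ApproachSpace Y) (f : X → Y) :
    PMat (Ultrafilter Y) X := fun 𝔶 x => b.conv 𝔶 (f x)

/-- Lawvere completeness: every adjunction of bimodules into `(X,a)` is induced by a functor.
The universe of the test spaces `Y` is arbitrary. -/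
def LawvereComplete {X : Type u} (a : ApproachSpace X) : Prop :=
  ∀ (Y : Type v) (b : ApproachSpace Y) (φ : PMat (Ultrafilter Y) X) (ψ : PMat (Ultrafilter X) Y),
    IsAdjoint b a φ ψ →
      ∃ f : Y → X, IsFunctor b a f ∧ lowerStar a f = φ ∧ upperStar a f = ψ

/-- Variable sets: families `(A_v)`, `v ∈ [0,∞]`, with `A_v = ⋂_{u > v} A_u`. -/
structure VariableSet (X : Type u) where
  level : ℝ≥0∞ → Set X
  level_eq : ∀ v, level v = ⋂ u > v, level u

namespace ApproachSpace

variable {X : Type u} (a : ApproachSpace X)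

/-- The point-set distance `d(A,x) = inf {a(𝔵,x) | 𝔵 ∈ UA}`, where `UA` is the set of ultrafilters
on `X` that contain `A`. -/
noncomputable def dist (A : Set X) (x : X) : ℝ≥0∞ :=
  ⨅ (𝔵 : Ultrafilter X) (_ : A ∈ 𝔵), a.conv 𝔵 x

/-- Closed variable sets. -/
def IsClosed (A : VariableSet X) : Prop :=
  ∀ (u v : ℝ≥0∞) (x : X), a.dist (A.level u) x ≤ v → x ∈ A.level (u + v)

/-- The family `𝒜_v = {𝔵 | a(𝔵,x) ≤ u + v for all u and all x ∈ A_u}` of sets of ultrafilters. -/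
def dualLevel (A : VariableSet X) (v : ℝ≥0∞) : Set (Ultrafilter X) :=
  {𝔵 | ∀ (u : ℝ≥0∞), ∀ x ∈ A.level u, a.conv 𝔵 x ≤ u + v}

/-- Irreducible variable sets: `UA_u ∩ 𝒜_u` is nonempty for all `u > 0`. -/
def IsIrreducible (A : VariableSet X) : Prop :=
  ∀ u : ℝ≥0∞, 0 < u → ({𝔵 : Ultrafilter X | A.level u ∈ 𝔵} ∩ a.dualLevel A u).Nonempty

/-- Representability of a variable set by a point. -/
def IsRepresentable (A : VariableSet X) : Prop :=
  ∃ x : X, ∀ v : ℝ≥0∞, A.level v = {y | a.dist {x} y ≤ v}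

end ApproachSpace

end UApp

/-! A variable set `A` is the same as a function `h : X → [0,∞]`, its height, with levels the
sublevel sets of `h`. Let `k(𝔵)` be the least `c` with `a(𝔵,x) ≤ h(x) + c` for all `x`. Closedness
makes `h` a bimodule from the one-point space, `k` is always a bimodule back with the counit
inequality, and irreducibility is what gives the unit (`isAdjoint_height`). A functor out of the
point inducing this adjunction picks a point representing `A`.

Conversely, given `φ ⊣ ψ` over any `Y`, each `φ(pure y, -)` is the height of a closed irreducible
variable set. Representing points give a map `f` with `φ(pure y, x) = a(pure (f y), x)`. This
agreement at principal ultrafilters already forces `ψ(pure (f y), y) = 0`, and the bimodule laws and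
counit then determine `ψ` and `φ` everywhere and make `f` a functor. -/

namespace UApp

section Ultrafilter

variable {X : Type u} {Y : Type v}

theorem mult_pure (𝔵 : Ultrafilter X) : mult (pure 𝔵) = 𝔵 :=
  Ultrafilter.ext fun _ => Iff.rfl

theorem mult_map_pure_comp (f : Y → X) (𝔶 : Ultrafilter Y) :
    mult (𝔶.map fun y => (pure (f y) : Ultrafilter X)) = 𝔶.map f :=
  Ultrafilter.ext fun _ => Iff.rfl

theorem eq_pure_of_singleton_mem {𝔵 : Ultrafilter X} {x : X} (h : {x} ∈ 𝔵) : 𝔵 = pure x :=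
  Ultrafilter.eq_of_le <| by
    rw [Ultrafilter.coe_pure, ← Filter.principal_singleton]
    exact Filter.le_principal_iff.2 h

/-- The only ultrafilter containing `{x}` is `pure x`. Hence a Kleisli composite at a principal
ultrafilter is an infimum over the middle ultrafilter alone. -/
theorem eq_pure_pure_of_mult_eq {𝔛 : Ultrafilter (Ultrafilter X)} {x : X}
    (h : mult 𝔛 = pure x) : 𝔛 = pure (pure x) := by
  have hx : {x} ∈ mult 𝔛 := h ▸ (rfl : x ∈ ({x} : Set X))
  refine eq_pure_of_singleton_mem (Filter.mem_of_superset ((mem_mult 𝔛 _).1 hx) ?_)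
  exact fun 𝔵 h𝔵 => eq_pure_of_singleton_mem h𝔵

instance subsingleton_ultrafilter [Subsingleton X] : Subsingleton (Ultrafilter X) := by
  refine ⟨fun 𝔵 𝔶 => ?_⟩
  obtain ⟨x, rfl⟩ := 𝔵.eq_pure_of_finite
  obtain ⟨y, rfl⟩ := 𝔶.eq_pure_of_finite
  rw [Subsingleton.elim x y]

end Ultrafilter

/-! ### Bounds for the ultrafilter extension of a matrix -/

namespace PMat

variable {X : Type u} {Y : Type v} {r : PMat X Y}

theorem ext_le {𝔵 : Ultrafilter X} {𝔶 : Ultrafilter Y} {c : ℝ≥0∞}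
    (h : ∀ A ∈ 𝔵, ∀ B ∈ 𝔶, ∃ x ∈ A, ∃ y ∈ B, r x y ≤ c) : r.ext 𝔵 𝔶 ≤ c := by
  refine iSup₂_le fun A hA => iSup₂_le fun B hB => ?_
  obtain ⟨x, hx, y, hy, hxy⟩ := h A hA B hB
  exact (iInf₂_le_of_le x hx (iInf₂_le y hy)).trans hxy

theorem ext_map_map_le {T : Type w} (𝔱 : Ultrafilter T) {f : T → X} {g : T → Y} {c : ℝ≥0∞}
    (h : ∀ t, r (f t) (g t) ≤ c) : r.ext (𝔱.map f) (𝔱.map g) ≤ c := by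
  refine ext_le fun A hA B hB => ?_
  obtain ⟨t, htA, htB⟩ := 𝔱.nonempty_of_mem (Filter.inter_mem hA hB)
  exact ⟨f t, htA, g t, htB, h t⟩

theorem ext_pure_pure_le (x : X) (y : Y) : r.ext (pure x) (pure y) ≤ r x y :=
  ext_le fun _ hA _ hB => ⟨x, hA, y, hB, le_rfl⟩

theorem ext_pure_left_le {x : X} {𝔶 : Ultrafilter Y} {c : ℝ≥0∞} (h : {y | r x y ≤ c} ∈ 𝔶) :
    r.ext (pure x) 𝔶 ≤ c := by
  refine ext_le fun A hA B hB => ?_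
  obtain ⟨y, hy, hyB⟩ := 𝔶.nonempty_of_mem (Filter.inter_mem h hB)
  exact ⟨x, hA, y, hyB, hy⟩

theorem ext_pure_right_le {𝔵 : Ultrafilter X} {y : Y} {c : ℝ≥0∞} (h : {x | r x y ≤ c} ∈ 𝔵) :
    r.ext 𝔵 (pure y) ≤ c := by
  refine ext_le fun A hA B hB => ?_
  obtain ⟨x, hx, hxA⟩ := 𝔵.nonempty_of_mem (Filter.inter_mem h hA)
  exact ⟨x, hxA, y, hB, hx⟩

/-- Otherwise the complement lies in `𝔶`, and the infimum over it is at least `c`. Strictness is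
essential, since values may tend to `c` from above along `𝔶`; hence the later arguments with
arbitrary larger bounds. -/
theorem mem_of_ext_pure_left_lt {x : X} {𝔶 : Ultrafilter Y} {c : ℝ≥0∞}
    (h : r.ext (pure x) 𝔶 < c) : {y | r x y ≤ c} ∈ 𝔶 := by
  by_contra hc
  refine h.not_ge ?_
  refine le_iSup₂_of_le {x} (rfl : x ∈ ({x} : Set X))
    (le_iSup₂_of_le _ (Ultrafilter.compl_mem_iff_notMem.2 hc) ?_)
  refine le_iInf₂ fun x' hx' => le_iInf₂ fun y hy => ?_
  obtain rfl : x' = x := hx'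
  exact le_of_not_ge (Set.notMem_of_mem_compl hy)

theorem mem_of_ext_pure_right_lt {𝔵 : Ultrafilter X} {y : Y} {c : ℝ≥0∞}
    (h : r.ext 𝔵 (pure y) < c) : {x | r x y ≤ c} ∈ 𝔵 := by
  by_contra hc
  refine h.not_ge ?_
  refine le_iSup₂_of_le _ (Ultrafilter.compl_mem_iff_notMem.2 hc)
    (le_iSup₂_of_le {y} (rfl : y ∈ ({y} : Set Y)) ?_)
  refine le_iInf₂ fun x hx => le_iInf₂ fun y' hy' => ?_
  obtain rfl : y' = y := hy'
  exact le_of_not_ge (Set.notMem_of_mem_compl hx)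

end PMat

section Kleisli

variable {X : Type u} {Y : Type v} {Z : Type w}
  {β : PMat (Ultrafilter Y) Z} {α : PMat (Ultrafilter X) Y}

theorem kleisli_le {𝔵 : Ultrafilter X} {𝔛 : Ultrafilter (Ultrafilter X)} (h : mult 𝔛 = 𝔵)
    (𝔶 : Ultrafilter Y) (z : Z) : kleisli β α 𝔵 z ≤ α.ext 𝔛 𝔶 + β 𝔶 z := by
  refine iInf_le_of_le 𝔶 (add_le_add_left (iInf_le_of_le 𝔛 ?_) _)
  simp [PMat.transpose, PMat.ofMap, h]

theorem le_kleisli {𝔵 : Ultrafilter X} {z : Z} {c : ℝ≥0∞}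
    (h : ∀ 𝔛 𝔶, mult 𝔛 = 𝔵 → c ≤ α.ext 𝔛 𝔶 + β 𝔶 z) : c ≤ kleisli β α 𝔵 z := by
  refine le_iInf fun 𝔶 => ?_
  rw [PMat.comp, ENNReal.iInf_add]
  refine le_iInf fun 𝔛 => ?_
  by_cases h𝔛 : mult 𝔛 = 𝔵
  · simpa [PMat.transpose, PMat.ofMap, h𝔛] using h 𝔛 𝔶 h𝔛
  · simp [PMat.transpose, PMat.ofMap, h𝔛]

theorem kleisli_pure_right_le (𝔵 : Ultrafilter X) (y : Y) (z : Z) :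
    kleisli β α 𝔵 z ≤ α 𝔵 y + β (pure y) z :=
  (kleisli_le (mult_pure 𝔵) (pure y) z).trans
    (add_le_add_left (PMat.ext_pure_pure_le 𝔵 y) _)

end Kleisli

theorem ApproachSpace.dist_singleton {X : Type u} (a : ApproachSpace X) (x y : X) :
    a.dist {x} y = a.conv (pure x) y := by
  refine le_antisymm (iInf₂_le (pure x) (rfl : x ∈ ({x} : Set X))) (le_iInf₂ fun 𝔵 h𝔵 => ?_)
  rw [eq_pure_of_singleton_mem h𝔵]

/-- The one-point space with trivial structure. -/
def pointSpace : ApproachSpace PUnit.{v + 1} where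
  conv _ _ := 0
  refl _ := le_rfl
  trans _ _ _ := bot_le

namespace VariableSet

variable {X : Type u}

/-- The variable set of sublevel sets of a function. -/
def ofFun (g : X → ℝ≥0∞) : VariableSet X where
  level v := {x | g x ≤ v}
  level_eq v := by
    ext x
    simpa using (forall_gt_imp_ge_iff_le_of_dense (a₁ := g x) (a₂ := v)).symm

variable (A : VariableSet X)

/-- The least level at which a point belongs to a variable set. -/
noncomputable def height (x : X) : ℝ≥0∞ := sInf {v | x ∈ A.level v}

theorem level_mono {u v : ℝ≥0∞} (h : u ≤ v) : A.level u ⊆ A.level v := by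
  intro x hx
  rw [A.level_eq] at hx ⊢
  exact Set.mem_iInter₂.2 fun w hw => Set.mem_iInter₂.1 hx w (h.trans_lt hw)

theorem mem_level_iff {x : X} {v : ℝ≥0∞} : x ∈ A.level v ↔ A.height x ≤ v := by
  refine ⟨fun h => sInf_le h, fun h => ?_⟩
  rw [A.level_eq]
  refine Set.mem_iInter₂.2 fun u hu => ?_
  obtain ⟨w, hw, hwu⟩ := sInf_lt_iff.1 (h.trans_lt hu)
  exact A.level_mono hwu.le hw

end VariableSet

/-! ### From variable sets to adjunctions over a point -/

namespace ApproachSpace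

variable {X : Type u} (a : ApproachSpace X) (A : VariableSet X)

/-- The least level at which an ultrafilter belongs to the dual levels of a variable set. -/
noncomputable def coheight (𝔵 : Ultrafilter X) : ℝ≥0∞ := ⨆ x, a.conv 𝔵 x - A.height x

theorem coheight_le_iff {𝔵 : Ultrafilter X} {v : ℝ≥0∞} :
    a.coheight A 𝔵 ≤ v ↔ ∀ x, a.conv 𝔵 x ≤ A.height x + v := by
  simp only [coheight, iSup_le_iff, tsub_le_iff_left]

theorem conv_le_height_add_coheight (𝔵 : Ultrafilter X) (x : X) :
    a.conv 𝔵 x ≤ A.height x + a.coheight A 𝔵 :=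
  (a.coheight_le_iff A).1 le_rfl x

theorem mem_dualLevel_iff {𝔵 : Ultrafilter X} {v : ℝ≥0∞} :
    𝔵 ∈ a.dualLevel A v ↔ a.coheight A 𝔵 ≤ v := by
  rw [coheight_le_iff]
  refine ⟨fun h x => h _ x (A.mem_level_iff.2 le_rfl), fun h u x hx => (h x).trans ?_⟩
  exact add_le_add_left (A.mem_level_iff.1 hx) _

/-- The matrix from the one-point space given by the heights of a variable set. -/
noncomputable def heightMat : PMat (Ultrafilter PUnit.{v + 1}) X := fun _ x => A.height x

/-- The matrix to the one-point space given by the coheights of a variable set. -/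
noncomputable def coheightMat : PMat (Ultrafilter X) PUnit.{v + 1} := fun 𝔵 _ => a.coheight A 𝔵

variable {a A}

/-- Transitivity of `a` through `pure x` reduces a bound at `mult 𝔛` to bounds holding for
`𝔛`-almost every ultrafilter. -/
theorem coheight_mult_le (𝔛 : Ultrafilter (Ultrafilter X)) (𝔷 : Ultrafilter PUnit.{v + 1}) :
    a.coheight A (mult 𝔛) ≤ (a.coheightMat A).ext 𝔛 𝔷 := by
  obtain ⟨z, rfl⟩ := 𝔷.eq_pure_of_finite
  refine le_of_forall_gt_imp_ge_of_dense fun c hc => ?_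
  refine (a.coheight_le_iff A).2 fun x => ?_
  have hconv : a.conv.ext 𝔛 (pure x) ≤ A.height x + c :=
    PMat.ext_pure_right_le <|
      Filter.mem_of_superset (PMat.mem_of_ext_pure_right_lt hc) fun 𝔵 h𝔵 =>
        (a.conv_le_height_add_coheight A 𝔵 x).trans (add_le_add_right h𝔵 _)
  simpa using (a.trans 𝔛 (pure x) x).trans (add_le_add hconv (a.refl x))

theorem height_le_of_isClosed (hA : a.IsClosed A)
    (𝔷 : Ultrafilter (Ultrafilter PUnit.{v + 1})) (𝔵 : Ultrafilter X) (x : X) :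
    A.height x ≤ (heightMat A).ext 𝔷 𝔵 + a.conv 𝔵 x := by
  obtain rfl : 𝔷 = pure (pure PUnit.unit) := Subsingleton.elim _ _
  -- Isolates the extension term, so that it can be replaced by any strictly larger `c`; then the
  -- level of `A` at `c` belongs to `𝔵` and closedness applies.
  rw [← tsub_le_iff_right]
  refine le_of_forall_gt_imp_ge_of_dense fun c hc => ?_
  rw [tsub_le_iff_right]
  refine A.mem_level_iff.1 (hA c _ x (iInf₂_le 𝔵 ?_))
  exact Filter.mem_of_superset (PMat.mem_of_ext_pure_left_lt hc) fun y hy =>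
    A.mem_level_iff.2 hy

theorem isAdjoint_height (hA : a.IsClosed A) (hI : a.IsIrreducible A) :
    IsAdjoint pointSpace.{v} a (heightMat A) (a.coheightMat A) where
  bimodule_left :=
    { right := fun _ _ => le_kleisli fun _ _ _ => le_add_self
      left := fun _ x => le_kleisli fun 𝔷 𝔵 _ => height_le_of_isClosed hA 𝔷 𝔵 x }
  bimodule_right :=
    { right := fun 𝔵 _ => le_kleisli fun 𝔛 𝔶 h => by
        subst h
        refine (a.coheight_le_iff A).2 fun x => (a.trans 𝔛 𝔶 x).trans ?_
        rw [add_left_comm]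
        exact add_le_add_right (a.conv_le_height_add_coheight A 𝔶 x) _
      left := fun 𝔵 _ => le_kleisli fun 𝔛 𝔷 h => by
        subst h
        exact (coheight_mult_le 𝔛 𝔷).trans le_self_add }
  unit := fun 𝔷 z => by
    refine le_of_forall_gt_imp_ge_of_dense fun c hc => ?_
    -- One half bounds the extended height at `𝔵`, the other its coheight.
    obtain ⟨𝔵, h𝔵, h𝔵'⟩ := hI (c / 2) (ENNReal.half_pos (bot_le.trans_lt hc).ne')
    refine (kleisli_le (mult_pure 𝔷) 𝔵 z).trans ?_
    rw [← ENNReal.add_halves c]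
    refine add_le_add (PMat.ext_pure_left_le ?_) ((a.mem_dualLevel_iff A).1 h𝔵')
    exact Filter.mem_of_superset h𝔵 fun x hx => A.mem_level_iff.1 hx
  counit := fun 𝔵 x => le_kleisli fun 𝔛 𝔷 h => by
    subst h
    refine (a.conv_le_height_add_coheight A _ x).trans ?_
    rw [add_comm]
    exact add_le_add_left (coheight_mult_le 𝔛 𝔷) _

end ApproachSpace

theorem LawvereComplete.isRepresentable {X : Type u} {a : ApproachSpace X}
    (h : LawvereComplete.{u, v} a) {A : VariableSet X} (hA : a.IsClosed A)
    (hI : a.IsIrreducible A) : a.IsRepresentable A := by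
  obtain ⟨f, -, hf, -⟩ := h _ _ _ _ (ApproachSpace.isAdjoint_height hA hI)
  refine ⟨f PUnit.unit, fun v => Set.ext fun x => ?_⟩
  have hx : a.conv (pure (f PUnit.unit)) x = A.height x :=
    congrFun (congrFun hf (pure PUnit.unit)) x
  rw [A.mem_level_iff, Set.mem_ofPred_eq, a.dist_singleton, hx]

/-! ### From adjunctions to variable sets and functors -/

namespace IsAdjoint

variable {X : Type u} {Y : Type v} {a : ApproachSpace X} {b : ApproachSpace Y}
  {φ : PMat (Ultrafilter Y) X} {ψ : PMat (Ultrafilter X) Y}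

theorem isClosed_ofFun (h : IsAdjoint b a φ ψ) (y : Y) :
    a.IsClosed (VariableSet.ofFun (φ (pure y))) := by
  intro u v x hx
  refine le_trans ?_ (add_le_add_right hx u)
  rw [ApproachSpace.dist, ENNReal.add_iInf₂]
  refine le_iInf₂ fun 𝔵 h𝔵 => (h.bimodule_left.left (pure y) x).trans ?_
  exact (kleisli_le (mult_pure _) 𝔵 x).trans (add_le_add_left (PMat.ext_pure_left_le h𝔵) _)

theorem kleisli_pure_eq_zero (h : IsAdjoint b a φ ψ) (y : Y) : kleisli ψ φ (pure y) y = 0 :=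
  le_bot_iff.1 ((h.unit (pure y) y).trans (b.refl y))

theorem exists_ext_add_lt (h : IsAdjoint b a φ ψ) (y : Y) {c : ℝ≥0∞} (hc : 0 < c) :
    ∃ 𝔵, φ.ext (pure (pure y)) 𝔵 + ψ 𝔵 y < c := by
  by_contra! H
  refine hc.not_ge ((h.kleisli_pure_eq_zero y).symm ▸ le_kleisli fun 𝔛 𝔵 h𝔛 => ?_)
  rw [eq_pure_pure_of_mult_eq h𝔛]
  exact H 𝔵

/-- An ultrafilter almost attaining the infimum in the unit serves as witness: its `φ`-term puts it
on the level, and the counit turns its `ψ`-term into the dual bound. -/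
theorem isIrreducible_ofFun (h : IsAdjoint b a φ ψ) (y : Y) :
    a.IsIrreducible (VariableSet.ofFun (φ (pure y))) := by
  intro u hu
  obtain ⟨𝔵, h𝔵⟩ := h.exists_ext_add_lt y hu
  refine ⟨𝔵, PMat.mem_of_ext_pure_left_lt (le_self_add.trans_lt h𝔵), fun w x hx => ?_⟩
  refine ((h.counit 𝔵 x).trans (kleisli_pure_right_le 𝔵 y x)).trans ?_
  rw [add_comm]
  exact add_le_add hx (le_add_self.trans h𝔵.le)

variable {f : Y → X}

theorem apply_pure_eq_zero (h : IsAdjoint b a φ ψ)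
    (hf : ∀ y x, φ (pure y) x = a.conv (pure (f y)) x) (y : Y) : ψ (pure (f y)) y = 0 := by
  refine le_bot_iff.1 (le_of_forall_gt_imp_ge_of_dense fun c hc => ?_)
  obtain ⟨𝔵, h𝔵⟩ := h.exists_ext_add_lt y hc
  refine (h.bimodule_right.right (pure (f y)) y).trans
    ((kleisli_le (mult_pure _) 𝔵 y).trans (le_trans (add_le_add_left ?_ _) h𝔵.le))
  -- By `hf`, the extension of `a` at `pure (pure (f y))` is bounded by that of `φ` at `pure (pure
  -- y)`.
  refine le_of_forall_gt_imp_ge_of_dense fun d hd => PMat.ext_pure_left_le ?_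
  simpa only [hf] using PMat.mem_of_ext_pure_left_lt hd

theorem upperStar_eq (h : IsAdjoint b a φ ψ)
    (hf : ∀ y x, φ (pure y) x = a.conv (pure (f y)) x) : upperStar a f = ψ := by
  funext 𝔵 y
  refine le_antisymm ?_ ?_
  · refine ((h.counit 𝔵 (f y)).trans (kleisli_pure_right_le 𝔵 y _)).trans ?_
    rw [hf]
    simpa using add_le_add_right (a.refl (f y)) (ψ 𝔵 y)
  · refine ((h.bimodule_right.right 𝔵 y).trans (kleisli_pure_right_le 𝔵 (f y) y)).trans ?_
    rw [h.apply_pure_eq_zero hf, add_zero, upperStar]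

/-- Passes from points to arbitrary `𝔶`: the ultrafilter on the left flattens to `𝔶.map f`, so
Kleisli composites at `𝔶.map f` can use it at no cost. -/
theorem ext_map_pure_eq_zero (h : IsAdjoint b a φ ψ)
    (hf : ∀ y x, φ (pure y) x = a.conv (pure (f y)) x) (𝔶 : Ultrafilter Y) :
    ψ.ext (𝔶.map fun y => pure (f y)) 𝔶 = 0 :=
  le_bot_iff.1 (PMat.ext_map_map_le 𝔶 (g := id) fun y => (h.apply_pure_eq_zero hf y).le)

theorem isFunctor (h : IsAdjoint b a φ ψ)
    (hf : ∀ y x, φ (pure y) x = a.conv (pure (f y)) x) : IsFunctor b a f := by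
  intro 𝔶 y
  change upperStar a f (𝔶.map f) y ≤ _
  rw [h.upperStar_eq hf]
  refine (h.bimodule_right.left (𝔶.map f) y).trans
    ((kleisli_le (mult_map_pure_comp f 𝔶) 𝔶 y).trans ?_)
  rw [h.ext_map_pure_eq_zero hf, zero_add]

theorem lowerStar_eq (h : IsAdjoint b a φ ψ)
    (hf : ∀ y x, φ (pure y) x = a.conv (pure (f y)) x) : lowerStar a f = φ := by
  funext 𝔶 x
  refine le_antisymm ?_ ?_
  · refine (h.counit (𝔶.map f) x).trans ((kleisli_le (mult_map_pure_comp f 𝔶) 𝔶 x).trans ?_)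
    rw [h.ext_map_pure_eq_zero hf, zero_add]
  -- Flattening the image of `𝔶` under `pure`, rather than `pure 𝔶`, leaves only the values `φ (pure
  -- y) (f y)`, which `hf` controls.
  · refine (h.bimodule_left.left 𝔶 x).trans
      ((kleisli_le (mult_map_pure_comp id 𝔶) (𝔶.map f) x).trans ?_)
    have h0 : φ.ext (𝔶.map fun y => pure (id y)) (𝔶.map f) ≤ 0 :=
      PMat.ext_map_map_le 𝔶 fun y => (hf y (f y)).trans_le (a.refl (f y))
    simpa [lowerStar] using add_le_add_left h0 (a.conv (𝔶.map f) x)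

end IsAdjoint

theorem lawvereComplete_of_isRepresentable {X : Type u} {a : ApproachSpace X}
    (h : ∀ A : VariableSet X, a.IsClosed A → a.IsIrreducible A → a.IsRepresentable A) :
    LawvereComplete.{u, v} a := by
  intro Y b φ ψ hadj
  choose f hf using fun y => h _ (hadj.isClosed_ofFun y) (hadj.isIrreducible_ofFun y)
  have hf' : ∀ y x, φ (pure y) x = a.conv (pure (f y)) x := by
    intro y x
    refine eq_of_forall_ge_iff fun v => ?_
    rw [← a.dist_singleton]
    exact Set.ext_iff.1 (hf y v) x
  exact ⟨f, hadj.isFunctor hf', hadj.lowerStar_eq hf', hadj.upperStar_eq hf'⟩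

end UApp

theorem theorem5p4 {X : Type u} (a : UApp.ApproachSpace X) :
    UApp.LawvereComplete.{u, v} a ↔
      ∀ A : UApp.VariableSet X, a.IsClosed A → a.IsIrreducible A → a.IsRepresentable A :=
  ⟨fun h _ hA hI => h.isRepresentable hA hI, UApp.lawvereComplete_of_isRepresentable⟩
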